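/- Let $K$ be a finite simplicial complex, let $\mathbb F$ be a field (in particular, any finite field), and let homology be simplicial (non-reduced) homology with coefficients in $\mathbb F$. Let $f:K\to\mathbb R$ be a discrete Morse function: for every $p$-dimensional simplex $\sigma\in K$ at most one $(p+1)$-dimensional simplex $\tau\succ\sigma$ satisfies $f(\tau)\le f(\sigma)$, and at most one $(p-1)$-dimensional simplex $\nu\prec\sigma$ satisfies $f(\sigma)\le f(\nu)$; $\sigma$ is critical if there is no such $\tau$ and no such $\nu$. Assume that $f$ is excellent, i.e. distinct critical simplices have distinct values. For $c\in\mathbb R$ let $K(c)$ be the subcomplex of all simplices $\sigma$ with $f(\sigma)\le c$ and all their faces. Let $c_1<\dots<c_n$ be real numbers containing all critical values of $f$, with $K(c_n)=K$ (for instance all values of $f$), put $K_i=K(c_i)$ and $K_0=\emptyset$, and consider the filtration $K_0\subseteq K_1\subseteq\dots\subseteq K_n=K$. A class $[h]\in H_q(K_i)$, $i\ge 1$, is *born* at level $i$ if it is not in the image of $H_q(K_{i-1})\to H_q(K_i)$. Such a class *dies* at level $j>i$ (with the elder rule) if its image in $H_q(K_j)$ lies in the image of $H_q(K_{i-1})\to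 H_q(K_j)$ (it has become zero or has merged with an older class), while its image in $H_q(K_{j-1})$ does not lie in the image of $H_q(K_{i-1})\to H_q(K_{j-1})$. A simplex $\sigma$ *marks* level $i$ if $f(\sigma)=c_i$ and no critical simplex other than $\sigma$ has the value $c_i$ (the second condition is automatic if $f$ is injective, or if $\sigma$ is critical). The pair $(\sigma,\tau)$ of simplices of $K$ is a *persistence pair* of $[h]$ if $[h]$ is born at a level marked by $\sigma$ and dies at a level marked by $\tau$. **Proposition.** Let $q\ge 0$, let $[h]\in H_q(K_i)$, and let $(\sigma,\tau)$ be a persistence pair of $[h]$. Then 1. $\dim\sigma=q$; 2. $\dim\tau=q+1$; 3. $[h]$ is represented by a cycle $z=\sum_k n_k\sigma_k\in Z_q(K_i)$ in which $\sigma$ appears, i.e. the coefficient of $\sigma$ in $z$ is non-zero. -/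

import Mathlib

set_option maxSynthPendingDepth 3

namespace MorsePersistence

/-! ### Simplicial homology over a field

Simplicial complexes are Mathlib's `PreAbstractSimplicialComplex V`: families of nonempty finite
subsets of `V`, closed under passing to nonempty subsets. A linear order on the vertices orients
every simplex. -/

/-- The dimension of a simplex with `n + 1` vertices is `n`. -/
def simplexDim {V : Type*} (s : Finset V) : ℕ := s.card - 1

/-- The boundary of an oriented simplex: the alternating sum of its facets; a vertex has
boundary `0` (homology is not reduced). -/
noncomputable def simplexBoundary {V : Type*} [LinearOrder V] (F : Type*) [Field F]
    (s : Finset V) : Finset V →₀ F :=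
  if 2 ≤ s.card then
    ∑ v ∈ s, Finsupp.single (s.erase v) ((-1 : F) ^ (s.filter (· < v)).card)
  else 0

/-- The boundary operator, as a linear map on finite linear combinations of finite vertex sets. -/
noncomputable def boundary (V : Type*) [LinearOrder V] (F : Type*) [Field F] :
    (Finset V →₀ F) →ₗ[F] (Finset V →₀ F) :=
  Finsupp.linearCombination F (simplexBoundary F)

/-- `C_q(K; F)`: the linear combinations of `q`-dimensional simplices of `K`. -/
noncomputable def chains {V : Type*} (F : Type*) [Field F]
    (K : PreAbstractSimplicialComplex V) (q : ℕ) : Submodule F (Finset V →₀ F) :=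
  Finsupp.supported F F {s : Finset V | s ∈ K ∧ s.card = q + 1}

/-- `Z_q(K)`: the `q`-cycles. -/
noncomputable def cycles {V : Type*} [LinearOrder V] (F : Type*) [Field F]
    (K : PreAbstractSimplicialComplex V) (q : ℕ) : Submodule F (Finset V →₀ F) :=
  chains F K q ⊓ LinearMap.ker (boundary V F)

/-- `B_q(K)`: the `q`-boundaries, images of the `(q + 1)`-chains. -/
noncomputable def boundaries {V : Type*} [LinearOrder V] (F : Type*) [Field F]
    (K : PreAbstractSimplicialComplex V) (q : ℕ) : Submodule F (Finset V →₀ F) :=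
  (chains F K (q + 1)).map (boundary V F)

/-- `H_q(K) = Z_q(K) / B_q(K)`. -/
abbrev Homology {V : Type*} [LinearOrder V] (F : Type*) [Field F]
    (K : PreAbstractSimplicialComplex V) (q : ℕ) : Type _ :=
  cycles F K q ⧸ (boundaries F K q).submoduleOf (cycles F K q)

/-- The homology class of a cycle. -/
noncomputable def homologyClass {V : Type*} [LinearOrder V] {F : Type*} [Field F]
    {K : PreAbstractSimplicialComplex V} {q : ℕ} (z : cycles F K q) : Homology F K q :=
  Submodule.Quotient.mk z

theorem chains_mono {V : Type*} (F : Type*) [Field F]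
    {K L : PreAbstractSimplicialComplex V} (h : K ≤ L) (q : ℕ) : chains F K q ≤ chains F L q :=
  Finsupp.supported_mono fun _ hs => ⟨h hs.1, hs.2⟩

theorem cycles_mono {V : Type*} [LinearOrder V] (F : Type*) [Field F]
    {K L : PreAbstractSimplicialComplex V} (h : K ≤ L) (q : ℕ) : cycles F K q ≤ cycles F L q :=
  inf_le_inf_right _ (chains_mono F h q)

/-- The map `H_q(K) → H_q(L)` induced by the inclusion of a subcomplex `K ≤ L`. -/
noncomputable def homologyMap {V : Type*} [LinearOrder V] (F : Type*) [Field F]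
    {K L : PreAbstractSimplicialComplex V} (h : K ≤ L) (q : ℕ) :
    Homology F K q →ₗ[F] Homology F L q :=
  Submodule.mapQ _ _ (Submodule.inclusion (cycles_mono F h q)) fun _ hz =>
    Submodule.map_mono (chains_mono F h (q + 1)) hz

/-! ### Discrete Morse functions -/

/-- `α` is a facet (a face of codimension one) of `β`. -/
def IsFacet {V : Type*} (α β : Finset V) : Prop :=
  α ⊆ β ∧ β.card = α.card + 1

/-- The cofacets `τ` of `σ` in `K` with `f τ ≤ f σ`. -/
def lowerCofacets {V : Type*} {K : PreAbstractSimplicialComplex V} (f : K → ℝ) (σ : K) : Set K :=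
  {τ | IsFacet (σ : Finset V) (τ : Finset V) ∧ f τ ≤ f σ}

/-- The facets `ν` of `σ` with `f σ ≤ f ν`. -/
def upperFacets {V : Type*} {K : PreAbstractSimplicialComplex V} (f : K → ℝ) (σ : K) : Set K :=
  {ν | IsFacet (ν : Finset V) (σ : Finset V) ∧ f σ ≤ f ν}

/-- Forman's definition of a discrete Morse function. -/
def IsDiscreteMorse {V : Type*} {K : PreAbstractSimplicialComplex V} (f : K → ℝ) : Prop :=
  ∀ σ : K, (lowerCofacets f σ).encard ≤ 1 ∧ (upperFacets f σ).encard ≤ 1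

/-- Critical simplices. -/
def IsCritical {V : Type*} {K : PreAbstractSimplicialComplex V} (f : K → ℝ) (σ : K) : Prop :=
  (lowerCofacets f σ).encard = 0 ∧ (upperFacets f σ).encard = 0

/-- Excellent: distinct critical simplices have distinct critical values. -/
def IsExcellent {V : Type*} {K : PreAbstractSimplicialComplex V} (f : K → ℝ) : Prop :=
  ∀ σ τ : K, IsCritical f σ → IsCritical f τ → f σ = f τ → σ = τ

/-- The sublevel complex `K(c)`: all simplices of value at most `c`, and all their faces. -/
def sublevel {V : Type*} {K : PreAbstractSimplicialComplex V} (f : K → ℝ) (c : ℝ) :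
    PreAbstractSimplicialComplex V where
  faces := {s | s.Nonempty ∧ ∃ t : K, s ⊆ (t : Finset V) ∧ f t ≤ c}
  isRelLowerSet_faces := by
    rintro s ⟨hs, t, hst, ht⟩
    exact ⟨hs, fun u hu hne => ⟨hne, t, subset_trans hu hst, ht⟩⟩

theorem sublevel_mono {V : Type*} {K : PreAbstractSimplicialComplex V} (f : K → ℝ) :
    Monotone (sublevel f) := by
  rintro a b hab s ⟨hs, t, hst, ht⟩
  exact ⟨hs, t, hst, ht.trans hab⟩

/-! ### The filtration and its persistence pairs -/

/-- A filtration `K(c_1) ⊆ ⋯ ⊆ K(c_n) = K` associated to `f`, given by reals `c_1 < ⋯ < c_n`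
(indexed here by `Fin n`) among which are all critical values of `f`. -/
structure MorseFiltration {V : Type*} {K : PreAbstractSimplicialComplex V} (f : K → ℝ) where
  /-- the number `n` of levels -/
  length : ℕ
  /-- the levels `c_1 < ⋯ < c_n` -/
  value : Fin length → ℝ
  strictMono_value : StrictMono value
  critical_mem : ∀ ρ : K, IsCritical f ρ → ∃ i, value i = f ρ
  exhaustive : ∀ s ∈ K, ∃ i, s ∈ sublevel f (value i)

namespace MorseFiltration

variable {V : Type*} {K : PreAbstractSimplicialComplex V} {f : K → ℝ}

/-- The stages of the filtration, with the empty complex put in front: stage `0` is empty, stage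
`i.succ` is the sublevel complex of the level `value i`, and stage `i.castSucc` is the one
immediately before it. -/
def stage (Φ : MorseFiltration f) (i : Fin (Φ.length + 1)) : PreAbstractSimplicialComplex V :=
  Fin.cases ⊥ (fun j => sublevel f (Φ.value j)) i

theorem stage_mono (Φ : MorseFiltration f) : Monotone Φ.stage := by
  intro i j hij
  induction i using Fin.cases with
  | zero => exact bot_le
  | succ i =>
    induction j using Fin.cases with
    | zero => exact absurd hij (by simp)
    | succ j => exact sublevel_mono f (Φ.strictMono_value.monotone (by simpa using hij))

variable [LinearOrder V] {F : Type*} [Field F] {q : ℕ}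

/-- The map in homology induced by the inclusion of an earlier into a later stage. -/
noncomputable def trans (Φ : MorseFiltration f) (F : Type*) [Field F] (q : ℕ)
    {i j : Fin (Φ.length + 1)} (hij : i ≤ j) :
    Homology F (Φ.stage i) q →ₗ[F] Homology F (Φ.stage j) q :=
  homologyMap F (Φ.stage_mono hij) q

/-- A class `h` in the homology of the `i`-th sublevel complex is born there if it does not come
from the preceding stage. -/
def IsBorn (Φ : MorseFiltration f) {i : Fin Φ.length} (h : Homology F (Φ.stage i.succ) q) : Prop :=
  h ∉ LinearMap.range (Φ.trans F q (Fin.castSucc_lt_succ (i := i)).le)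

/-- The image of the class `h` in the homology of a later stage comes from the stage preceding the
birth of `h`: the class has become zero or has merged with an older class. -/
def IsAbsorbed (Φ : MorseFiltration f) {i : Fin Φ.length} (h : Homology F (Φ.stage i.succ) q)
    {k : Fin (Φ.length + 1)} (hk : i.succ ≤ k) : Prop :=
  Φ.trans F q hk h ∈
    LinearMap.range (Φ.trans F q ((Fin.castSucc_lt_succ (i := i)).le.trans hk))

/-- Death of a class `h` born at level `i`, with the elder rule (of two merging classes the younger
one dies): `h` dies entering the `j`-th sublevel complex, `i < j`, if it is absorbed there but not
yet at the stage immediately before. -/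
def Dies (Φ : MorseFiltration f) {i : Fin Φ.length} (h : Homology F (Φ.stage i.succ) q)
    (j : Fin Φ.length) (hij : i < j) : Prop :=
  ¬ Φ.IsAbsorbed h (Fin.succ_le_castSucc_iff.2 hij) ∧
    Φ.IsAbsorbed h (Fin.succ_le_succ_iff.2 hij.le)

/-- `σ` is a simplex marking the level `i`: it has the value of that level, and this value is not
the value of a critical simplex other than `σ`. -/
def Marks (Φ : MorseFiltration f) (σ : K) (i : Fin Φ.length) : Prop :=
  f σ = Φ.value i ∧ ∀ ρ : K, IsCritical f ρ → f ρ = Φ.value i → ρ = σ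

/-- `(σ, τ)` is the persistence pair of the class `h`: `h` is born at `σ` and dies at `τ`. -/
def IsPersistencePair (Φ : MorseFiltration f) {i : Fin Φ.length}
    (h : Homology F (Φ.stage i.succ) q) (σ τ : K) : Prop :=
  (Φ.IsBorn h ∧ Φ.Marks σ i) ∧ ∃ (j : Fin Φ.length) (hij : i < j), Φ.Dies h j hij ∧ Φ.Marks τ j

end MorseFiltration

end MorsePersistence

namespace MorsePersistence

/-! ### Simplicial chains -/

section Chains

variable {V : Type*}

/-! At a marked level the only critical simplex that can enter is the marking one
(`apply_eq_value`). A chain of the new stage with boundary in the old stage, and free of new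
critical simplices, can be pushed into the old stage modulo boundaries
(`IsDiscreteMorse.exists_sub_boundary_mem`). New simplices matched with a cofacet are traded for its
other facets (`single_mem_sup`). If only new simplices matched with a facet remain, the highest such
facet would survive in the boundary, so there are none (`mem_chains_of_boundary`).

Applied to a cycle avoiding `σ`, this contradicts birth, so `σ` appears in every representative and
has dimension `q`. Applied to a `(q + 1)`-chain bounding a difference of old cycles, it shows that
homology injects when `τ` does not have dimension `q + 1`, whereas death requires a kernel. -/

theorem nonempty_of_mem {K : PreAbstractSimplicialComplex V} {s : Finset V} (hs : s ∈ K) :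
    s.Nonempty :=
  (K.isRelLowerSet_faces hs).1

theorem mem_of_subset {K : PreAbstractSimplicialComplex V} {s t : Finset V} (ht : t ∈ K)
    (hst : s ⊆ t) (hs : s.Nonempty) : s ∈ K :=
  (K.isRelLowerSet_faces ht).2 hst hs

theorem IsFacet.ne {s t : Finset V} (h : IsFacet s t) : s ≠ t := by
  rintro rfl
  exact absurd h.2 (by omega)

theorem mem_chains {F : Type*} [Field F] {K : PreAbstractSimplicialComplex V} {q : ℕ}
    {c : Finset V →₀ F} :
    c ∈ chains F K q ↔ ∀ s, c s ≠ 0 → s ∈ K ∧ s.card = q + 1 := by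
  rw [chains, Finsupp.mem_supported]
  simp [Set.subset_def]

variable [LinearOrder V]

theorem isFacet_erase {s : Finset V} {v : V} (hv : v ∈ s) : IsFacet (s.erase v) s :=
  ⟨s.erase_subset v, by
    have := Finset.card_pos.2 ⟨v, hv⟩
    rw [Finset.card_erase_of_mem hv]; omega⟩

theorem IsFacet.exists_erase {s t : Finset V} (h : IsFacet t s) : ∃ v ∈ s, s.erase v = t := by
  obtain ⟨v, hv⟩ := Finset.card_eq_one.1
    (show (s \ t).card = 1 by rw [Finset.card_sdiff_of_subset h.1, h.2]; omega)
  have hvs : v ∈ s := (Finset.mem_sdiff.1 (hv ▸ Finset.mem_singleton_self v)).1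
  refine ⟨v, hvs, ?_⟩
  rw [Finset.erase_eq, ← hv, Finset.sdiff_sdiff_eq_self h.1]

variable (F : Type*) [Field F]

theorem simplexBoundary_erase_ne_zero {s : Finset V} (hs : 2 ≤ s.card) {v : V} (hv : v ∈ s) :
    simplexBoundary F s (s.erase v) ≠ 0 := by
  rw [simplexBoundary, if_pos hs, Finsupp.finsetSum_apply, Finset.sum_eq_single v]
  · simp
  · intro w hw hwv
    exact Finsupp.single_eq_of_ne fun h => hwv (s.erase_injOn hw hv h.symm)
  · exact fun h => absurd hv h

theorem isFacet_of_simplexBoundary_ne_zero {s t : Finset V} (h : simplexBoundary F s t ≠ 0) :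
    IsFacet t s ∧ 2 ≤ s.card := by
  rw [simplexBoundary] at h
  split_ifs at h with hs
  · refine ⟨?_, hs⟩
    rw [Finsupp.finsetSum_apply] at h
    obtain ⟨v, hv, hne⟩ := Finset.exists_ne_zero_of_sum_ne_zero h
    obtain rfl : t = s.erase v := by
      by_contra hn
      exact hne (Finsupp.single_eq_of_ne hn)
    exact isFacet_erase hv
  · exact absurd rfl h

theorem simplexBoundary_ne_zero_of_isFacet {s t : Finset V} (h : IsFacet t s)
    (ht : t.Nonempty) : simplexBoundary F s t ≠ 0 := by
  obtain ⟨v, hv, rfl⟩ := h.exists_erase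
  refine simplexBoundary_erase_ne_zero F ?_ hv
  have := ht.card_pos
  have := h.2
  omega

theorem boundary_single (s : Finset V) : boundary V F (Finsupp.single s 1) = simplexBoundary F s := by
  simp [boundary]

theorem boundary_apply (c : Finset V →₀ F) (t : Finset V) :
    boundary V F c t = ∑ s ∈ c.support, c s * simplexBoundary F s t := by
  simp [boundary, Finsupp.linearCombination_apply, Finsupp.sum, Finsupp.finsetSum_apply]

/-- Deleting two vertices in either order gives the same face with opposite signs, so swapping the
order is a cancelling involution. -/
theorem boundary_simplexBoundary (s : Finset V) : boundary V F (simplexBoundary F s) = 0 := by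
  by_cases hs : 3 ≤ s.card
  · rw [simplexBoundary, if_pos (by omega), map_sum]
    have key : ∀ v ∈ s, boundary V F (Finsupp.single (s.erase v)
        ((-1 : F) ^ (s.filter (· < v)).card)) = ∑ w ∈ s.erase v,
          Finsupp.single ((s.erase v).erase w)
            ((-1 : F) ^ (s.filter (· < v)).card * (-1) ^ ((s.erase v).filter (· < w)).card) := by
      intro v hv
      have h2 : 2 ≤ (s.erase v).card := by rw [Finset.card_erase_of_mem hv]; omega
      simp [boundary, simplexBoundary, h2, Finset.smul_sum]
    rw [Finset.sum_congr rfl key, Finset.sum_sigma']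
    refine Finset.sum_involution (fun x _ => ⟨x.2, x.1⟩) ?_ ?_ ?_ ?_
    · have aux : ∀ v w : V, v ∈ s → v < w →
          (-1 : F) ^ (s.filter (· < v)).card * (-1) ^ ((s.erase v).filter (· < w)).card +
          (-1 : F) ^ (s.filter (· < w)).card * (-1) ^ ((s.erase w).filter (· < v)).card = 0 := by
        intro v w hv hvw
        have e1 : (s.erase w).filter (· < v) = s.filter (· < v) := by
          ext x
          simp only [Finset.mem_filter, Finset.mem_erase]
          exact ⟨fun h => ⟨h.1.2, h.2⟩, fun h => ⟨⟨(h.2.trans hvw).ne, h.1⟩, h.2⟩⟩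
        have e2 : (s.filter (· < w)).card = ((s.erase v).filter (· < w)).card + 1 := by
          rw [Finset.filter_erase, Finset.card_erase_add_one]
          simp [hv, hvw]
        rw [e1, e2, pow_succ]
        ring
      rintro ⟨v, w⟩ h
      obtain ⟨hv, hw⟩ := Finset.mem_sigma.1 h
      obtain ⟨hne, hw⟩ := Finset.mem_erase.1 hw
      simp only at hv hw hne ⊢
      rw [Finset.erase_right_comm (a := w), ← Finsupp.single_add]
      rcases lt_or_gt_of_ne hne with hlt | hlt
      · rw [add_comm, aux w v hw hlt, Finsupp.single_zero]
      · rw [aux v w hv hlt, Finsupp.single_zero]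
    · rintro ⟨v, w⟩ h _ heq
      obtain ⟨hv, hw⟩ := Finset.mem_sigma.1 h
      exact (Finset.mem_erase.1 hw).1 (congrArg Sigma.fst heq)
    · rintro ⟨v, w⟩ h
      simp only [Finset.mem_sigma, Finset.mem_erase] at h ⊢
      exact ⟨h.2.2, h.2.1.symm, h.1⟩
    · rintro ⟨v, w⟩ h
      rfl
  -- With at most two vertices every facet is at most a vertex, whose boundary is zero by
  -- convention.
  · ext t
    rw [boundary_apply]
    refine Finset.sum_eq_zero fun r hr => ?_
    by_contra hne
    obtain ⟨-, h2⟩ := isFacet_of_simplexBoundary_ne_zero F (right_ne_zero_of_mul hne)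
    obtain ⟨h3, -⟩ := isFacet_of_simplexBoundary_ne_zero F (left_ne_zero_of_mul hne)
    have := h3.2
    omega

theorem boundary_boundary (c : Finset V →₀ F) : boundary V F (boundary V F c) = 0 := by
  have : boundary V F ∘ₗ boundary V F = 0 := by
    refine Finsupp.lhom_ext' fun s => LinearMap.ext_ring ?_
    simpa [boundary_single] using boundary_simplexBoundary F s
  exact LinearMap.congr_fun this c

end Chains

/-! ### Sublevel complexes of discrete Morse functions -/

section Morse

variable {V : Type*} {K : PreAbstractSimplicialComplex V} {f : K → ℝ}

theorem mem_of_mem_sublevel {s : Finset V} {x : ℝ} (hs : s ∈ sublevel f x) : s ∈ K := by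
  obtain ⟨hne, t, hst, -⟩ := hs
  exact mem_of_subset t.2 hst hne

theorem mem_sublevel_of_le {s t : K} {x : ℝ} (hst : (s : Finset V) ⊆ t) (h : f t ≤ x) :
    (s : Finset V) ∈ sublevel f x :=
  ⟨nonempty_of_mem s.2, t, hst, h⟩

theorem IsDiscreteMorse.eq_of_lowerCofacets (hf : IsDiscreteMorse f) {s t u : K}
    (ht : t ∈ lowerCofacets f s) (hu : u ∈ lowerCofacets f s) : t = u :=
  Set.encard_le_one_iff.1 (hf s).1 t u ht hu

theorem IsDiscreteMorse.eq_of_upperFacets (hf : IsDiscreteMorse f) {s t u : K}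
    (ht : t ∈ upperFacets f s) (hu : u ∈ upperFacets f s) : t = u :=
  Set.encard_le_one_iff.1 (hf s).2 t u ht hu

theorem isCritical_iff {s : K} :
    IsCritical f s ↔ lowerCofacets f s = ∅ ∧ upperFacets f s = ∅ := by
  simp only [IsCritical, Set.encard_eq_zero]

/-- A simplex lying in a sublevel complex without having a small enough value itself has a cofacet
with small enough value. -/
theorem IsDiscreteMorse.exists_cofacet [DecidableEq V] (hf : IsDiscreteMorse f) {s : K} {x : ℝ}
    (hs : (s : Finset V) ∈ sublevel f x) (hx : x < f s) :
    ∃ t : K, IsFacet (s : Finset V) (t : Finset V) ∧ f t ≤ x := by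
  obtain ⟨-, t, hst, ht⟩ := hs
  induction hn : ((t : Finset V) \ s).card using Nat.strong_induction_on generalizing t with
  | _ n ih =>
  have hcard := Finset.card_sdiff_add_card_eq_card hst
  rcases lt_trichotomy n 1 with h | h | h
  · have : s = t := Subtype.ext (Finset.eq_of_subset_of_card_le hst (by omega))
    subst this
    exact absurd ht (not_le.2 hx)
  · exact ⟨t, ⟨hst, by omega⟩, ht⟩
  -- Two distinct facets of `t` contain `s`. At most one can have value at least `f t`, so the
  -- descent continues through the other.
  · obtain ⟨v, hv, w, hw, hvw⟩ := Finset.one_lt_card.1 (hn ▸ h)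
    have hsub : ∀ u ∈ (t : Finset V) \ s, (s : Finset V) ⊆ (t : Finset V).erase u := fun u hu =>
      Finset.subset_erase.2 ⟨hst, (Finset.mem_sdiff.1 hu).2⟩
    let e : ∀ u ∈ (t : Finset V) \ s, K := fun u hu =>
      ⟨(t : Finset V).erase u, mem_of_subset t.2 (Finset.erase_subset _ _)
        ((nonempty_of_mem s.2).mono (hsub u hu))⟩
    have hfac : ∀ u (hu : u ∈ (t : Finset V) \ s),
        IsFacet (e u hu : Finset V) (t : Finset V) := fun u hu => by
      have hut := (Finset.mem_sdiff.1 hu).1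
      exact ⟨Finset.erase_subset _ _, (Finset.card_erase_add_one hut).symm⟩
    have hstep : ∀ u (hu : u ∈ (t : Finset V) \ s), f (e u hu) < f t →
        ∃ t : K, IsFacet (s : Finset V) (t : Finset V) ∧ f t ≤ x := fun u hu hlt => by
      have hc := Finset.card_sdiff_add_card_eq_card (hsub u hu)
      have := (hfac u hu).2
      exact ih (((t : Finset V).erase u) \ s).card (by simp only [e] at this; omega) (e u hu)
        (hsub u hu) (hlt.le.trans ht) rfl
    by_cases h1 : f (e v hv) < f t
    · exact hstep v hv h1
    by_cases h2 : f (e w hw) < f t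
    · exact hstep w hw h2
    have heq := hf.eq_of_upperFacets ⟨hfac v hv, not_lt.1 h1⟩ ⟨hfac w hw, not_lt.1 h2⟩
    exact absurd ((t : Finset V).erase_injOn (Finset.mem_sdiff.1 hv).1 (Finset.mem_sdiff.1 hw).1
      (congrArg Subtype.val heq)) hvw

/-- Entering early, as a face only, would require a cofacet of smaller value, which a critical
simplex lacks. -/
theorem IsDiscreteMorse.le_of_isCritical [DecidableEq V] (hf : IsDiscreteMorse f) {s : K} {x : ℝ}
    (hs : (s : Finset V) ∈ sublevel f x) (hc : IsCritical f s) : f s ≤ x := by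
  by_contra! hx
  obtain ⟨t, hst, ht⟩ := hf.exists_cofacet hs hx
  exact ((isCritical_iff.1 hc).1.subset (show t ∈ lowerCofacets f s from ⟨hst, ht.trans hx.le⟩))

/-- The cofacet with which a simplex is matched lies in the same sublevel complexes. -/
theorem IsDiscreteMorse.le_of_mem_lowerCofacets [DecidableEq V] (hf : IsDiscreteMorse f)
    {s t : K} {x : ℝ} (hs : (s : Finset V) ∈ sublevel f x) (ht : t ∈ lowerCofacets f s) :
    f t ≤ x := by
  rcases le_or_gt (f s) x with h | h
  · exact ht.2.trans h
  · obtain ⟨u, hsu, hu⟩ := hf.exists_cofacet hs h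
    rwa [hf.eq_of_lowerCofacets ht ⟨hsu, hu.trans h.le⟩]

end Morse

/-! ### Pushing chains down -/

section Descent

variable {V : Type*} [LinearOrder V] {F : Type*} [Field F] {K : PreAbstractSimplicialComplex V}
  {f : K → ℝ} {a b : ℝ}

/-- The non-critical simplices of `K(b)` outside `K(a)` that are not matched with a facet can be
removed from a chain by adding boundaries. -/
theorem IsDiscreteMorse.single_mem_sup [Finite K] (hf : IsDiscreteMorse f)
    (hcrit : ∀ ρ : K, IsCritical f ρ → (ρ : Finset V) ∈ sublevel f b →
      (ρ : Finset V) ∉ sublevel f a → f ρ = b)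
    {q : ℕ} (s : K) (hs : (s : Finset V) ∈ sublevel f b) (hcard : (s : Finset V).card = q + 1)
    (hns : IsCritical f s → (s : Finset V) ∈ sublevel f a) :
    (Finsupp.single (s : Finset V) 1 : Finset V →₀ F) ∈
      Finsupp.supported F F {t : Finset V | (t ∈ sublevel f b ∧ t.card = q + 1) ∧
        (t ∉ sublevel f a → ∃ u : K, (u : Finset V) = t ∧ (upperFacets f u).Nonempty)} ⊔
      boundaries F (sublevel f b) q := by
  set M := Finsupp.supported F F {t : Finset V | (t ∈ sublevel f b ∧ t.card = q + 1) ∧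
        (t ∉ sublevel f a → ∃ u : K, (u : Finset V) = t ∧ (upperFacets f u).Nonempty)} ⊔
      boundaries F (sublevel f b) q with hM
  have wf : WellFounded (fun x y : K => f x < f y) :=
    haveI : IsTrans K fun x y => f x < f y := ⟨fun _ _ _ => lt_trans⟩
    haveI : Std.Irrefl fun x y : K => f x < f y := ⟨fun _ => lt_irrefl _⟩
    Finite.wellFounded_of_trans_of_irrefl _
  induction s using wf.induction with
  | _ s ih =>
  by_cases hgood : (s : Finset V) ∉ sublevel f a →
      ∃ u : K, (u : Finset V) = s ∧ (upperFacets f u).Nonempty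
  · exact Submodule.mem_sup_left (Finsupp.single_mem_supported F _ ⟨⟨hs, hcard⟩, hgood⟩)
  push Not at hgood
  obtain ⟨hsa, hup⟩ := hgood
  obtain ⟨t, ht⟩ : (lowerCofacets f s).Nonempty := by
    rw [Set.nonempty_iff_ne_empty]
    intro h
    exact hsa (hns (isCritical_iff.2 ⟨h, hup s rfl⟩))
  have htb : f t ≤ b := hf.le_of_mem_lowerCofacets hs ht
  have hcoef := simplexBoundary_ne_zero_of_isFacet F ht.1 (nonempty_of_mem s.2)
  have hbd : simplexBoundary F (t : Finset V) ∈ M := by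
    refine Submodule.mem_sup_right ⟨Finsupp.single (t : Finset V) 1, ?_, boundary_single F _⟩
    exact Finsupp.single_mem_supported F _
      ⟨mem_sublevel_of_le subset_rfl htb, by rw [ht.1.2, hcard]⟩
  have hrest : (simplexBoundary F (t : Finset V)).erase (s : Finset V) ∈ M := by
    rw [← Finsupp.sum_single ((simplexBoundary F (t : Finset V)).erase (s : Finset V)),
      Finsupp.sum]
    refine Submodule.sum_mem _ fun r hr => ?_
    rw [Finsupp.support_erase, Finset.mem_erase, Finsupp.mem_support_iff] at hr
    obtain ⟨hrs, hr⟩ := hr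
    obtain ⟨hrt, h2⟩ := isFacet_of_simplexBoundary_ne_zero F hr
    have hrc := hrt.2
    have htc := ht.1.2
    have hrK : r ∈ K := mem_of_subset t.2 hrt.1 (Finset.card_pos.1 (by omega))
    -- The simplex `s` already is the one facet of `t` allowed a value at least `f t`; hence `f r <
    -- f t ≤ f s` and the induction applies.
    have hlt : f ⟨r, hrK⟩ < f t := by
      by_contra! hle
      exact hrs (congrArg Subtype.val (hf.eq_of_upperFacets (s := t) (t := ⟨r, hrK⟩) (u := s)
        ⟨hrt, hle⟩ ⟨ht.1, ht.2⟩))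
    have hmem : (Finsupp.single r 1 : Finset V →₀ F) ∈ M := by
      refine ih ⟨r, hrK⟩ (hlt.trans_le ht.2) (mem_sublevel_of_le hrt.1 htb)
        (by simp only; omega) fun hc => ?_
      -- A new critical simplex has value exactly `b`, but `f r < f t ≤ b`.
      by_contra hra
      have := hcrit ⟨r, hrK⟩ hc (mem_sublevel_of_le hrt.1 htb) hra
      linarith
    rw [← mul_one (Finsupp.erase _ _ _), ← smul_eq_mul, ← Finsupp.smul_single]
    exact M.smul_mem _ hmem
  -- The coefficient of `s` in the boundary of `t` is invertible, so `s` can be solved for.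
  have hdiff := M.smul_mem (simplexBoundary F (t : Finset V) s)⁻¹ (M.sub_mem hbd hrest)
  rw [← Finsupp.single_add_erase (s : Finset V) (simplexBoundary F (t : Finset V))] at hdiff
  simpa [hcoef] using hdiff

/-- A chain whose simplices outside `K(a)` are all matched with a facet lies in `K(a)` as soon as
its boundary does. -/
theorem IsDiscreteMorse.mem_chains_of_boundary (hf : IsDiscreteMorse f) {q : ℕ}
    {c : Finset V →₀ F}
    (hc : c ∈ Finsupp.supported F F {t : Finset V | (t ∈ sublevel f b ∧ t.card = q + 1) ∧
        (t ∉ sublevel f a → ∃ u : K, (u : Finset V) = t ∧ (upperFacets f u).Nonempty)})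
    (hbd : ∀ t ∉ sublevel f a, boundary V F c t = 0) : c ∈ chains F (sublevel f a) q := by
  have hc' : ∀ t, c t ≠ 0 → (t ∈ sublevel f b ∧ t.card = q + 1) ∧
        (t ∉ sublevel f a → ∃ u : K, (u : Finset V) = t ∧ (upperFacets f u).Nonempty) :=
    fun t ht => hc (Finsupp.mem_support_iff.2 ht)
  by_contra hnot
  -- The facets matched with the new simplices of `c`; one of maximal value will have a non-zero
  -- coefficient in the boundary.
  let P : Set K := {v | ∃ u : K, c u ≠ 0 ∧ (u : Finset V) ∉ sublevel f a ∧ v ∈ upperFacets f u}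
  have hfin : P.Finite := by
    have h1 : {u : K | c u ≠ 0}.Finite :=
      (c.support.finite_toSet.preimage Subtype.val_injective.injOn).subset
        fun u hu => Finsupp.mem_support_iff.2 hu
    refine (h1.biUnion (t := fun u => upperFacets f u) fun u _ =>
      Set.finite_of_encard_le_coe (k := 1) (hf u).2).subset ?_
    rintro v ⟨u, hu, -, hv⟩
    exact Set.mem_biUnion hu hv
  have hne : P.Nonempty := by
    rw [mem_chains] at hnot
    push Not at hnot
    obtain ⟨s, hs, hsa⟩ := hnot
    obtain ⟨⟨-, h1⟩, h2⟩ := hc' s hs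
    have hsa' : s ∉ sublevel f a := fun h => hsa h h1
    obtain ⟨u, rfl, v, hv⟩ := h2 hsa'
    exact ⟨v, u, hs, hsa', hv⟩
  obtain ⟨v, ⟨t, ht0, hta, hvt⟩, hmax⟩ := Set.exists_max_image P f hfin hne
  have hva : (v : Finset V) ∉ sublevel f a := fun hva =>
    hta (mem_sublevel_of_le subset_rfl (hf.le_of_mem_lowerCofacets hva ⟨hvt.1, hvt.2⟩))
  have hcoef := hbd _ hva
  rw [boundary_apply, Finset.sum_eq_single (t : Finset V)] at hcoef
  · exact mul_ne_zero ht0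
      (simplexBoundary_ne_zero_of_isFacet F hvt.1 (nonempty_of_mem v.2)) hcoef
  · intro r hr hrt
    rw [Finsupp.mem_support_iff] at hr
    by_contra hne
    obtain ⟨hvr, -⟩ := isFacet_of_simplexBoundary_ne_zero F (right_ne_zero_of_mul hne)
    obtain ⟨-, h2⟩ := hc' r hr
    have hra : r ∉ sublevel f a := fun hra =>
      hva (mem_of_subset hra hvr.1 (nonempty_of_mem v.2))
    obtain ⟨u, rfl, w, hw⟩ := h2 hra
    -- Maximality gives `f r ≤ f w ≤ f v`, making `r` a second lower cofacet of `v`; uniqueness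
    -- forces `r = t`.
    have hle := hmax w ⟨u, hr, hra, hw⟩
    exact hrt (congrArg Subtype.val (hf.eq_of_lowerCofacets (s := v)
      ⟨hvr, hw.2.trans hle⟩ ⟨hvt.1, hvt.2⟩))
  · exact fun h => absurd (Finsupp.mem_support_iff.2 ht0) h

/-- A chain of `K(b)` with boundary in `K(a)`, in which no critical simplex outside `K(a)` appears,
differs by a boundary from a chain of `K(a)`. -/
theorem IsDiscreteMorse.exists_sub_boundary_mem [Finite K] (hf : IsDiscreteMorse f)
    (hcrit : ∀ ρ : K, IsCritical f ρ → (ρ : Finset V) ∈ sublevel f b →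
      (ρ : Finset V) ∉ sublevel f a → f ρ = b)
    {q : ℕ} {c : Finset V →₀ F} (hc : c ∈ chains F (sublevel f b) q)
    (hbd : ∀ t ∉ sublevel f a, boundary V F c t = 0)
    (hzero : ∀ ρ : K, IsCritical f ρ → (ρ : Finset V) ∉ sublevel f a → c ρ = 0) :
    ∃ d ∈ chains F (sublevel f b) (q + 1), c - boundary V F d ∈ chains F (sublevel f a) q := by
  have hmem : c ∈ Finsupp.supported F F {t : Finset V | (t ∈ sublevel f b ∧ t.card = q + 1) ∧
        (t ∉ sublevel f a → ∃ u : K, (u : Finset V) = t ∧ (upperFacets f u).Nonempty)} ⊔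
      boundaries F (sublevel f b) q := by
    rw [← Finsupp.sum_single c, Finsupp.sum]
    refine Submodule.sum_mem _ fun s hs => ?_
    rw [Finsupp.mem_support_iff] at hs
    obtain ⟨hsb, hcard⟩ := mem_chains.1 hc s hs
    rw [← mul_one (c s), ← smul_eq_mul, ← Finsupp.smul_single]
    refine Submodule.smul_mem _ _ (hf.single_mem_sup hcrit ⟨s, mem_of_mem_sublevel hsb⟩ hsb hcard
      fun hcr => ?_)
    by_contra hsa
    exact hs (hzero _ hcr hsa)
  obtain ⟨g, hg, _, ⟨d, hd, rfl⟩, rfl⟩ := Submodule.mem_sup.1 hmem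
  refine ⟨d, hd, ?_⟩
  rw [add_sub_cancel_right]
  refine hf.mem_chains_of_boundary hg fun t ht => ?_
  simpa [boundary_boundary] using hbd t ht

end Descent

/-! ### Homology classes -/

section Homology

variable {V : Type*} [LinearOrder V] {F : Type*} [Field F]
  {K L M : PreAbstractSimplicialComplex V} {q : ℕ}

theorem homologyClass_surjective (h : Homology F K q) : ∃ z : cycles F K q, homologyClass z = h :=
  Submodule.Quotient.mk_surjective _ h

theorem homologyClass_eq_iff {z w : cycles F K q} :
    homologyClass z = homologyClass w ↔
      ∃ d ∈ chains F K (q + 1), boundary V F d = (z : Finset V →₀ F) - w := by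
  rw [homologyClass, homologyClass, Submodule.Quotient.eq]
  rfl

theorem homologyMap_homologyClass (h : K ≤ L) (z : cycles F K q) :
    homologyMap F h q (homologyClass z) =
      homologyClass (Submodule.inclusion (cycles_mono F h q) z) :=
  rfl

theorem homologyMap_homologyMap (h : K ≤ L) (h' : L ≤ M) (x : Homology F K q) :
    homologyMap F h' q (homologyMap F h q x) = homologyMap F (h.trans h') q x := by
  obtain ⟨z, rfl⟩ := homologyClass_surjective x
  rfl

end Homology

/-! ### Stages of a filtration -/

namespace MorseFiltration

variable {V : Type*} {K : PreAbstractSimplicialComplex V} {f : K → ℝ}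

/-- Every stage, including the empty one, is a sublevel complex. -/
theorem exists_stage_eq_sublevel [Finite K] (Φ : MorseFiltration f) (i : Fin (Φ.length + 1)) :
    ∃ a, Φ.stage i = sublevel f a := by
  induction i using Fin.cases with
  | succ i => exact ⟨Φ.value i, rfl⟩
  | zero =>
    obtain ⟨m, hm⟩ := (Set.finite_range f).bddBelow
    -- Strictly below every value of `f`, so the sublevel complex is empty.
    refine ⟨m - 1, le_antisymm bot_le ?_⟩
    rintro s ⟨-, t, -, ht⟩
    have := hm (Set.mem_range_self t)
    linarith

variable [LinearOrder V] {F : Type*} [Field F] {q : ℕ}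

/-- The only critical simplices entering at a stage are those with the value of its level. -/
theorem apply_eq_value (Φ : MorseFiltration f) (hf : IsDiscreteMorse f) {i : Fin Φ.length} {ρ : K}
    (hρ : IsCritical f ρ) (hi : (ρ : Finset V) ∈ Φ.stage i.succ)
    (hi' : (ρ : Finset V) ∉ Φ.stage i.castSucc) : f ρ = Φ.value i := by
  obtain ⟨k, hk⟩ := Φ.critical_mem ρ hρ
  have hle : f ρ ≤ Φ.value i := hf.le_of_isCritical hi hρ
  rw [← hk] at hle ⊢
  rcases (Φ.strictMono_value.le_iff_le.1 hle).eq_or_lt with rfl | hlt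
  · rfl
  · refine absurd (Φ.stage_mono (Fin.succ_le_castSucc_iff.2 hlt) ?_) hi'
    exact mem_sublevel_of_le (f := f) subset_rfl hk.ge

/-- A chain entering at a level marked by `σ`, with boundary in the preceding stage and in which
`σ` does not appear, differs by a boundary from a chain of the preceding stage. -/
theorem exists_sub_boundary_mem [Finite K] (Φ : MorseFiltration f) (hf : IsDiscreteMorse f)
    {i : Fin Φ.length} {σ : K} (hσ : Φ.Marks σ i) {c : Finset V →₀ F}
    (hc : c ∈ chains F (Φ.stage i.succ) q)
    (hbd : ∀ t ∉ Φ.stage i.castSucc, boundary V F c t = 0) (hzero : c σ = 0) :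
    ∃ d ∈ chains F (Φ.stage i.succ) (q + 1),
      c - boundary V F d ∈ chains F (Φ.stage i.castSucc) q := by
  have hval := fun (ρ : K) (hρ : IsCritical f ρ) => Φ.apply_eq_value hf (i := i) hρ
  obtain ⟨a, ha⟩ := Φ.exists_stage_eq_sublevel i.castSucc
  rw [ha] at hbd hval ⊢
  refine hf.exists_sub_boundary_mem (b := Φ.value i) hval hc hbd fun ρ hρ hρa => ?_
  by_contra hne
  have hρi := (mem_chains.1 hc _ hne).1
  exact hne (hσ.2 ρ hρ (hval ρ hρ hρi hρa) ▸ hzero)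

/-- A simplex marking the level where a class is born appears in every cycle of this class. -/
theorem IsBorn.apply_ne_zero [Finite K] {Φ : MorseFiltration f} (hf : IsDiscreteMorse f)
    {i : Fin Φ.length} {z : cycles F (Φ.stage i.succ) q} (hz : Φ.IsBorn (homologyClass z)) {σ : K}
    (hσ : Φ.Marks σ i) : (z : Finset V →₀ F) σ ≠ 0 := by
  intro h0
  have hz0 : boundary V F z = 0 := z.2.2
  obtain ⟨d, hd, hw⟩ := Φ.exists_sub_boundary_mem hf hσ z.2.1 (fun t _ => by simp [hz0]) h0
  refine hz ⟨homologyClass ⟨z - boundary V F d, hw, ?_⟩, ?_⟩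
  · simp [hz0, boundary_boundary]
  · refine Eq.symm (homologyClass_eq_iff.2 ⟨d, hd, ?_⟩)
    simp

/-- If a simplex `τ` marking a level is not of dimension `q + 1`, then the `q`-th homology of the
preceding stage injects into that of the stage at this level. -/
theorem trans_injective [Finite K] (Φ : MorseFiltration f) (hf : IsDiscreteMorse f)
    {j : Fin Φ.length} {τ : K} (hτ : Φ.Marks τ j) (hcard : (τ : Finset V).card ≠ q + 2) :
    Function.Injective (Φ.trans F q (Fin.castSucc_lt_succ (i := j)).le) := by
  intro x y hxy
  obtain ⟨z, rfl⟩ := homologyClass_surjective x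
  obtain ⟨w, rfl⟩ := homologyClass_surjective y
  simp only [trans, homologyMap_homologyClass] at hxy
  obtain ⟨c, hc, hcb⟩ := homologyClass_eq_iff.1 hxy
  simp only [Submodule.coe_inclusion] at hcb
  obtain ⟨d, -, hd⟩ := Φ.exists_sub_boundary_mem hf hτ hc (fun t ht => by
      rw [hcb]
      by_contra hne
      exact ht (mem_chains.1 (sub_mem z.2.1 w.2.1) t hne).1)
    -- The simplices of `c` have `q + 2` vertices, so `τ` is not among them.
    (by
      by_contra hne
      exact hcard (mem_chains.1 hc _ hne).2)
  -- Subtracting a boundary does not change the boundary of `c`, so `z - w` already bounds in the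
  -- old stage.
  exact homologyClass_eq_iff.2 ⟨_, hd, by simp [boundary_boundary, hcb]⟩

/-- A class can only die at a level where the map in homology is not injective. -/
theorem Dies.not_injective {Φ : MorseFiltration f} {i j : Fin Φ.length} {hij : i < j}
    {h : Homology F (Φ.stage i.succ) q} (hd : Φ.Dies h j hij) :
    ¬ Function.Injective (Φ.trans F q (Fin.castSucc_lt_succ (i := j)).le) := by
  obtain ⟨hn, g, hg⟩ := hd
  -- The images of `g` and `h` agree at level `j`; injectivity would make them agree one stage
  -- earlier.
  refine fun hinj => hn ⟨g, hinj ?_⟩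
  simp only [trans, homologyMap_homologyMap] at hg ⊢
  exact hg

end MorseFiltration

end MorsePersistence

open MorsePersistence in
theorem proposition3p4 {V : Type*} [LinearOrder V] {F : Type*} [Field F]
    (K : PreAbstractSimplicialComplex V) [Finite K] (f : K → ℝ)
    (hf : IsDiscreteMorse f) (hexc : IsExcellent f) (Φ : MorseFiltration f)
    (q : ℕ) (i : Fin Φ.length) (h : Homology F (Φ.stage i.succ) q) (σ τ : K)
    (hpair : Φ.IsPersistencePair h σ τ) :
    simplexDim (σ : Finset V) = q ∧
      simplexDim (τ : Finset V) = q + 1 ∧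
      ∃ z : cycles F (Φ.stage i.succ) q,
        homologyClass z = h ∧ (z : Finset V →₀ F) (σ : Finset V) ≠ 0 := by
  obtain ⟨⟨hborn, hσ⟩, j, hij, hdies, hτ⟩ := hpair
  obtain ⟨z, rfl⟩ := homologyClass_surjective h
  have hne := hborn.apply_ne_zero hf hσ
  refine ⟨?_, ?_, z, rfl, hne⟩
  · rw [simplexDim, (mem_chains.1 z.2.1 _ hne).2, Nat.add_sub_cancel]
  · by_contra hdim
    refine hdies.not_injective (Φ.trans_injective hf hτ fun hcard => hdim ?_)
    rw [simplexDim, hcard, Nat.add_succ_sub_one]
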